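/- Let $H \subset \mathbb{R}^n$ be finite. For $S \subseteq \mathbb{R}^n$ and $x \in \mathbb{R}^n$ let $A_S(x) = (\mathrm{sign}\langle x,h\rangle : h \in S) \in \{-,0,+\}^S$, and let $S-S=\{h'-h'' : h',h''\in S\}$. We say that $S$ infers $h \in \mathbb{R}^n$ at $x$ if $\mathrm{sign}\langle x',h\rangle=\mathrm{sign}\langle x,h\rangle$ for all $x'\in\mathbb{R}^n$ with $A_{S\cup(S-S)}(x')=A_{S\cup(S-S)}(x)$. The inference dimension of $H$ is the minimal integer $d\ge 1$ such that for every $S\subseteq H$ with $|S|\ge d$ and every $x\in\mathbb{R}^n$ there is $h\in S$ such that $S\setminus\{h\}$ infers $h$ at $x$. A comparison decision tree for $A_H$ is a finite ternary decision tree each of whose inner nodes queries $\mathrm{sign}\langle q,x\rangle$ for some $q\in H\cup(H-H)$ and branches on the answer, and whose output is $A_H(x)$ for every input $x\in\mathbb{R}^n$. A zero-error randomized comparison decision tree computing $A_H$ is a probability distribution over such trees $T$; its expected query complexity is the maximum over $x\in\mathbb{R}^n$ of the expected number of queries performed by $T$ on $x$. **Theorem.** There is an absolute constant $C>0$ such that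 for every $n$ and every finite $H\subset\mathbb{R}^n$ with $|H|\ge 2$ and inference dimension $d$, there exists a zero-error randomized comparison decision tree which computes $A_H$ and whose expected query complexity is at most $C\,(d+n\log d)\log|H|$. -/

import Mathlib

open scoped Pointwise ENNReal

namespace PointLocation

noncomputable section

/-- The space `ℝⁿ` with its standard inner product. -/
abbrev Vec (n : ℕ) : Type := EuclideanSpace ℝ (Fin n)

/-- The point-location function `A_S(x) = (sign ⟪x, h⟫ : h ∈ S)`; `SignType` is `{-, 0, +}`. -/
def signPattern {n : ℕ} (S : Set (Vec n)) (x : Vec n) : S → SignType :=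
  fun h => SignType.sign (inner ℝ x (h : Vec n))

/-- `P_S(x)`: the points that give the same answers as `x` to all label queries and all
comparison queries on `S`. Here `S - S = {h' - h'' : h', h'' ∈ S}`. -/
def cell {n : ℕ} (S : Set (Vec n)) (x : Vec n) : Set (Vec n) :=
  {x' | signPattern (S ∪ (S - S)) x' = signPattern (S ∪ (S - S)) x}

/-- `S` infers `h` at `x`. -/
def Infers {n : ℕ} (S : Set (Vec n)) (h x : Vec n) : Prop :=
  ∀ x' ∈ cell S x, SignType.sign (inner ℝ x' h) = SignType.sign (inner ℝ x h)

/-- The inference dimension of `H` is `d`: `d` is the least integer `≥ 1` such that for every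
`S ⊆ H` with at least `d` elements (possibly infinite) and every `x`, some `h ∈ S` is inferred
at `x` by `S \ {h}`. -/
def IsInferenceDimension {n : ℕ} (H : Set (Vec n)) (d : ℕ) : Prop :=
  IsLeast {k : ℕ | 1 ≤ k ∧ ∀ S : Set (Vec n), S ⊆ H → (k : ℕ∞) ≤ S.encard →
    ∀ x : Vec n, ∃ h ∈ S, Infers (S \ {h}) h x} d

/-- Linear decision trees on inputs `x ∈ ℝⁿ`: a leaf carries an output, and an inner node queries
`sign ⟪q, x⟫` and branches on the answer. -/
inductive LinearDecisionTree (n : ℕ) (α : Type) : Type where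
  | leaf (output : α) : LinearDecisionTree n α
  | node (q : Vec n) (child : SignType → LinearDecisionTree n α) : LinearDecisionTree n α

namespace LinearDecisionTree

variable {n : ℕ} {α : Type}

/-- The output of the tree on input `x`. -/
def eval : LinearDecisionTree n α → Vec n → α
  | leaf a, _ => a
  | node q child, x => (child (SignType.sign (inner ℝ q x))).eval x

/-- The number of queries that the tree performs on input `x`. -/
def numQueries : LinearDecisionTree n α → Vec n → ℕ
  | leaf _, _ => 0
  | node q child, x => (child (SignType.sign (inner ℝ q x))).numQueries x + 1

/-- Every query of the tree belongs to `Q`. -/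
def QueriesIn (Q : Set (Vec n)) : LinearDecisionTree n α → Prop
  | leaf _ => True
  | node q child => q ∈ Q ∧ ∀ s, (child s).QueriesIn Q

/-- A comparison tree for `H`: each query is a label query (`h ∈ H`) or a comparison query
(`h' - h''` with `h', h'' ∈ H`). -/
def IsComparison (H : Set (Vec n)) (T : LinearDecisionTree n α) : Prop :=
  T.QueriesIn (H ∪ (H - H))

/-- The tree computes `A_H(x)` correctly on all inputs `x`. -/
def Computes (H : Set (Vec n)) (T : LinearDecisionTree n (H → SignType)) : Prop :=
  ∀ x, T.eval x = signPattern H x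

end LinearDecisionTree

/-- A zero-error randomized comparison decision tree for `A_H`: a probability distribution over
deterministic comparison decision trees, each of which computes `A_H` correctly on all inputs.
For finite `H` there are only countably many comparison trees, so that discrete distributions are
all distributions. -/
structure ZeroErrorComparisonTree {n : ℕ} (H : Set (Vec n)) where
  dist : PMF (LinearDecisionTree n (H → SignType))
  isComparison : ∀ T ∈ dist.support, T.IsComparison H
  computes : ∀ T ∈ dist.support, T.Computes H

/-- The expected number of queries on input `x`. -/
def ZeroErrorComparisonTree.expectedQueries {n : ℕ} {H : Set (Vec n)}
    (R : ZeroErrorComparisonTree H) (x : Vec n) : ℝ≥0∞ :=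
  ∑' T : LinearDecisionTree n (H → SignType), R.dist T * (T.numQueries x : ℝ≥0∞)

/-- The expected query complexity: the maximum over the inputs of the expected number of queries. -/
def ZeroErrorComparisonTree.expectedQueryComplexity {n : ℕ} {H : Set (Vec n)}
    (R : ZeroErrorComparisonTree H) : ℝ≥0∞ :=
  ⨆ x : Vec n, R.expectedQueries x

end

end PointLocation

/-!
To label `G ⊆ H`, sort a random sample `S ⊆ G` of `2 * d` elements, that is, locate the cell of the
input for `S`; this labels all elements that `S` infers, and the rest is labelled recursively.

Sorting costs `O(d + n * log d)` queries instead of `O(d * log d)`: adding a hyperplane to an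
arrangement creates at most two new faces for each face of the arrangement induced on it, so the
`O(d ^ 2)` label and comparison queries on `S` have only `d ^ O(n)` combinations of answers. A new
element is inserted into the sorted list by binary search, guided by the median sign of each query
over the remaining combinations: a sign that deviates from the median discards half of them, and two
queries whose signs agree with it finish the insertion.

By double counting pairs `(S, h)` through `S ∪ {h}`, of which fewer than `d` elements are not
inferred by the others, the expected number of elements not inferred by `S` is at most half of
`G.card`. By Jensen's inequality, `log (1 + G.card)` then drops by a constant on average, so that
`O(log H.card)` rounds suffice in expectation.
-/

namespace PointLocation

section SignVectors

variable {K E : Type*} [Field K] [LinearOrder K] [IsStrictOrderedRing K] [AddCommGroup E]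
  [Module K E]

/-- The sign vectors realized by a family of linear functionals, i.e. the faces of the arrangement
of the hyperplanes `f i = 0`. -/
def signVectors {ι : Type*} (f : ι → Module.Dual K E) : Set (ι → SignType) :=
  Set.range fun x i => SignType.sign (f i x)

theorem sign_add_mul_eq_of_sign_eq {a b c d : K} (hab : SignType.sign a = SignType.sign b)
    (hc : 0 ≤ c) (hd : 0 ≤ d) (hcd : 0 < c + d) :
    SignType.sign (c * a + d * b) = SignType.sign a := by
  obtain hc | hd : 0 < c ∨ 0 < d := by by_contra!; linarith
  all_goals
    rcases lt_trichotomy a 0 with ha | rfl | ha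
    · have hb : b < 0 := sign_eq_neg_one_iff.mp (hab ▸ sign_neg ha)
      rw [sign_neg ha, sign_eq_neg_one_iff]
      nlinarith
    · have hb : b = 0 := sign_eq_zero_iff.mp (hab ▸ sign_zero)
      simp [hb]
    · have hb : 0 < b := sign_eq_one_iff.mp (hab ▸ sign_pos ha)
      rw [sign_pos ha, sign_eq_one_iff]
      nlinarith

theorem abs_mul_add_abs_mul_eq_zero {a b : K} (hab : SignType.sign a ≠ SignType.sign b) :
    |b| * a + |a| * b = 0 := by
  rcases lt_trichotomy a 0 with ha | rfl | ha <;> rcases lt_trichotomy b 0 with hb | rfl | hb <;>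
    simp_all [abs_of_neg, abs_of_pos, mul_comm]

theorem exists_mem_ker_sign_eq {ι : Type*} (f : ι → Module.Dual K E) (g : Module.Dual K E)
    {x y : E} (hf : ∀ i, SignType.sign (f i x) = SignType.sign (f i y))
    (hg : SignType.sign (g x) ≠ SignType.sign (g y)) :
    ∃ z ∈ LinearMap.ker g, ∀ i, SignType.sign (f i z) = SignType.sign (f i x) := by
  have hpos : 0 < |g y| + |g x| := by
    by_contra! h
    have hx : g x = 0 := abs_eq_zero.mp (by linarith [abs_nonneg (g x), abs_nonneg (g y)])
    have hy : g y = 0 := abs_eq_zero.mp (by linarith [abs_nonneg (g x), abs_nonneg (g y)])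
    exact hg (by rw [hx, hy])
  -- Up to scaling, this is where the segment from `x` to `y` crosses the hyperplane `g = 0`.
  refine ⟨|g y| • x + |g x| • y, ?_, fun i => ?_⟩
  · simpa using abs_mul_add_abs_mul_eq_zero hg
  · simpa using sign_add_mul_eq_of_sign_eq (hf i) (abs_nonneg _) (abs_nonneg _) hpos

theorem card_le_card_image_add_mul_card {α β : Type*} [DecidableEq β] {s : Finset α} {g : α → β}
    {t : Finset β} {k : ℕ} (hk : ∀ b, (s.filter fun a => g a = b).card ≤ k + 1)
    (ht : ∀ a ∈ s, ∀ a' ∈ s, g a = g a' → a ≠ a' → g a ∈ t) :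
    s.card ≤ (s.image g).card + k * t.card := by
  have hfiber (b : β) : (s.filter fun a => g a = b).card ≤ 1 + if b ∈ t then k else 0 := by
    split_ifs with hb
    · exact (hk b).trans_eq (add_comm k 1)
    · refine Finset.card_le_one.mpr fun a ha a' ha' => ?_
      rw [Finset.mem_filter] at ha ha'
      by_contra hne
      exact hb (ha.2 ▸ ht a ha.1 a' ha'.1 (ha.2.trans ha'.2.symm) hne)
  calc s.card = ∑ b ∈ s.image g, (s.filter fun a => g a = b).card :=
        Finset.card_eq_sum_card_image g s
    _ ≤ ∑ b ∈ s.image g, (1 + if b ∈ t then k else 0) := Finset.sum_le_sum fun b _ => hfiber b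
    _ = (s.image g).card + (s.image g ∩ t).card * k := by simp [Finset.sum_add_distrib]
    _ ≤ (s.image g).card + k * t.card := by
        rw [mul_comm]
        gcongr
        exact Finset.inter_subset_right

theorem ncard_signVectors_succ_le {m : ℕ} (f : Fin (m + 1) → Module.Dual K E) :
    (signVectors f).ncard ≤ (signVectors (Fin.tail f)).ncard +
      2 * (signVectors fun i => (Fin.tail f i).domRestrict (LinearMap.ker (f 0))).ncard := by
  classical
  simp only [Set.ncard_eq_toFinset_card']
  refine (card_le_card_image_add_mul_card (g := Fin.tail) (k := 2) (fun v => ?_) ?_).trans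
    (Nat.add_le_add_right (Finset.card_le_card ?_) _)
  · refine (Finset.card_le_card_of_injOn (t := Finset.univ) (· 0) (by simp) ?_).trans_eq (by rfl)
    intro s hs s' hs' h0
    rw [Finset.mem_coe, Finset.mem_filter] at hs hs'
    exact funext (Fin.cases h0 (congrFun (hs.2.trans hs'.2.symm)))
  · simp only [Set.mem_toFinset]
    rintro _ ⟨x, rfl⟩ _ ⟨y, rfl⟩ htail hne
    have hf (i : Fin m) := congrFun htail i
    have h0 : SignType.sign (f 0 x) ≠ SignType.sign (f 0 y) := fun h0 =>
      hne (funext (Fin.cases h0 hf))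
    obtain ⟨z, hz, hzx⟩ := exists_mem_ker_sign_eq (Fin.tail f) (f 0) hf h0
    exact ⟨⟨z, hz⟩, funext hzx⟩
  · simp only [Finset.subset_iff, Finset.mem_image, Set.mem_toFinset]
    rintro _ ⟨_, ⟨x, rfl⟩, rfl⟩
    exact ⟨x, rfl⟩

theorem ncard_signVectors_le [FiniteDimensional K E] {m : ℕ} (f : Fin m → Module.Dual K E) :
    (signVectors f).ncard ≤ (2 * m + 1) ^ Module.finrank K E := by
  induction m generalizing E with
  | zero => simpa using Set.ncard_le_one_of_subsingleton (signVectors f)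
  | succ m ih =>
    by_cases h0 : f 0 = 0
    · have hinj : Set.InjOn Fin.tail (signVectors f) := by
        rintro _ ⟨x, rfl⟩ _ ⟨y, rfl⟩ htail
        exact funext (Fin.cases (by simp [h0]) (congrFun htail))
      calc (signVectors f).ncard
          ≤ (signVectors (Fin.tail f)).ncard :=
            Set.ncard_le_ncard_of_injOn Fin.tail (by rintro _ ⟨x, rfl⟩; exact ⟨x, rfl⟩) hinj
        _ ≤ (2 * m + 1) ^ Module.finrank K E := ih _
        _ ≤ (2 * (m + 1) + 1) ^ Module.finrank K E := by gcongr; omega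
    · have hrank := Module.Dual.finrank_ker_add_one_of_ne_zero h0
      set r := Module.finrank K (LinearMap.ker (f 0))
      calc (signVectors f).ncard
          ≤ (2 * m + 1) ^ Module.finrank K E + 2 * (2 * m + 1) ^ r :=
            (ncard_signVectors_succ_le f).trans (by gcongr <;> apply ih)
        _ = (2 * m + 1) ^ r * (2 * (m + 1) + 1) := by rw [← hrank]; ring
        _ ≤ (2 * (m + 1) + 1) ^ r * (2 * (m + 1) + 1) := by gcongr; omega
        _ = (2 * (m + 1) + 1) ^ Module.finrank K E := by rw [← hrank, pow_succ]

end SignVectors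

section SignPattern

variable {n : ℕ} {Q Q' : Set (Vec n)} {x y : Vec n}

theorem signPattern_eq_iff : signPattern Q x = signPattern Q y ↔
    ∀ q ∈ Q, SignType.sign (inner ℝ x q) = SignType.sign (inner ℝ y q) := by
  simp [funext_iff, signPattern]

theorem signPattern_eq_mono (hQ : Q' ⊆ Q) (h : signPattern Q x = signPattern Q y) :
    signPattern Q' x = signPattern Q' y :=
  signPattern_eq_iff.mpr fun q hq => signPattern_eq_iff.mp h q (hQ hq)

theorem exists_finset_forall_exists_signPattern_eq (Q : Finset (Vec n)) :
    ∃ X : Finset (Vec n), X.card ≤ (2 * Q.card + 1) ^ n ∧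
      ∀ x, ∃ y ∈ X, signPattern (Q : Set (Vec n)) y = signPattern (Q : Set (Vec n)) x := by
  let f (i : Fin Q.card) : Module.Dual ℝ (Vec n) := innerₛₗ ℝ (Q.equivFin.symm i : Vec n)
  let v (x : Vec n) (i : Fin Q.card) : SignType := SignType.sign (f i x)
  obtain ⟨X, himage, hinj⟩ := Set.exists_image_eq_and_injOn Set.univ v
  rw [Set.image_univ] at himage
  have hX : X.Finite := (Set.toFinite (v '' X)).of_finite_image hinj
  refine ⟨hX.toFinset, ?_, fun x => ?_⟩
  · calc hX.toFinset.card = (signVectors f).ncard := by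
          rw [← Set.ncard_eq_toFinset_card X hX, ← hinj.ncard_image, himage]; rfl
      _ ≤ (2 * Q.card + 1) ^ n := by simpa using ncard_signVectors_le f
  · obtain ⟨y, hy, hyx⟩ : v x ∈ v '' X := himage ▸ Set.mem_range_self x
    refine ⟨y, hX.mem_toFinset.mpr hy, signPattern_eq_iff.mpr fun q hq => ?_⟩
    simpa [v, f, real_inner_comm] using congrFun hyx (Q.equivFin ⟨q, hq⟩)

end SignPattern

namespace LinearDecisionTree

variable {n : ℕ} {α β : Type} {Q Q' : Set (Vec n)} {T : LinearDecisionTree n α} {x y : Vec n}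

instance [Nonempty α] : Nonempty (LinearDecisionTree n α) := Nonempty.map leaf ‹_›

theorem QueriesIn.mono (h : T.QueriesIn Q) (hQ : Q ⊆ Q') : T.QueriesIn Q' := by
  induction T with
  | leaf a => trivial
  | node q child ih => exact ⟨hQ h.1, fun s => ih s (h.2 s)⟩

theorem IsComparison.mono {H H' : Set (Vec n)} (h : T.IsComparison H) (hH : H ⊆ H') :
    T.IsComparison H' :=
  QueriesIn.mono h (Set.union_subset_union hH (Set.sub_subset_sub hH hH))

theorem QueriesIn.eval_eq (h : T.QueriesIn Q) (hxy : signPattern Q x = signPattern Q y) :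
    T.eval x = T.eval y := by
  induction T with
  | leaf a => rfl
  | node q child ih =>
    have hq := signPattern_eq_iff.mp hxy q h.1
    rw [real_inner_comm, real_inner_comm q y] at hq
    simp only [eval, hq, ih _ (h.2 _)]

theorem QueriesIn.numQueries_eq (h : T.QueriesIn Q) (hxy : signPattern Q x = signPattern Q y) :
    T.numQueries x = T.numQueries y := by
  induction T with
  | leaf a => rfl
  | node q child ih =>
    have hq := signPattern_eq_iff.mp hxy q h.1
    rw [real_inner_comm, real_inner_comm q y] at hq
    simp only [numQueries, hq, ih _ (h.2 _)]

/-- Sequential composition: continue with the tree `k a` at every leaf with output `a`. -/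
def bind : LinearDecisionTree n α → (α → LinearDecisionTree n β) → LinearDecisionTree n β
  | leaf a, k => k a
  | node q child, k => node q fun s => (child s).bind k

theorem eval_bind (T : LinearDecisionTree n α) (k : α → LinearDecisionTree n β) (x : Vec n) :
    (T.bind k).eval x = (k (T.eval x)).eval x := by
  induction T with
  | leaf a => rfl
  | node q _ ih => exact ih _

theorem numQueries_bind (T : LinearDecisionTree n α) (k : α → LinearDecisionTree n β)
    (x : Vec n) :
    (T.bind k).numQueries x = T.numQueries x + (k (T.eval x)).numQueries x := by
  induction T with
  | leaf a => simp [bind, eval, numQueries]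
  | node q child ih => simp only [bind, eval, numQueries, ih, add_right_comm]

theorem QueriesIn.bind (h : T.QueriesIn Q) {k : α → LinearDecisionTree n β}
    (hk : ∀ a, (k a).QueriesIn Q) : (T.bind k).QueriesIn Q := by
  induction T with
  | leaf a => exact hk a
  | node q child ih => exact ⟨h.1, fun s => ih s (h.2 s)⟩

/-- Relabelling: apply `f` to the outputs of a tree. -/
def map (f : α → β) (T : LinearDecisionTree n α) : LinearDecisionTree n β :=
  T.bind fun a => leaf (f a)

theorem eval_map (f : α → β) (T : LinearDecisionTree n α) (x : Vec n) :
    (T.map f).eval x = f (T.eval x) := eval_bind _ _ _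

theorem numQueries_map (f : α → β) (T : LinearDecisionTree n α) (x : Vec n) :
    (T.map f).numQueries x = T.numQueries x := numQueries_bind _ _ _

theorem QueriesIn.map (h : T.QueriesIn Q) (f : α → β) : (T.map f).QueriesIn Q :=
  h.bind fun _ => trivial

theorem exists_eval_eq_sign (F : Finset (Vec n)) :
    ∃ T : LinearDecisionTree n (Vec n → SignType), T.QueriesIn (F : Set (Vec n)) ∧
      ∀ x, (∀ q ∈ F, T.eval x q = SignType.sign (inner ℝ x q)) ∧ T.numQueries x = F.card := by
  classical
  induction F using Finset.induction_on with
  | empty => exact ⟨leaf 0, trivial, by simp [numQueries]⟩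
  | insert p F hp ih =>
    obtain ⟨T, hT, hTx⟩ := ih
    refine ⟨node p fun s => T.map fun v => Function.update v p s,
      ⟨by simp, fun s => (hT.mono (by simp)).map _⟩, fun x => ⟨fun q hq => ?_, ?_⟩⟩
    · rw [eval, eval_map]
      obtain rfl | hne := eq_or_ne q p
      · rw [Function.update_self, real_inner_comm]
      · rw [Function.update_of_ne hne, (hTx x).1 q (Finset.mem_of_mem_insert_of_ne hq hne)]
    · rw [numQueries, numQueries_map, (hTx x).2, Finset.card_insert_of_notMem hp]

end LinearDecisionTree

section Search

theorem exists_median {α β : Type*} [LinearOrder β] [Nonempty β] (X : Finset α) (f : α → β) :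
    ∃ m, 2 * (X.filter fun x => f x < m).card ≤ X.card ∧
      2 * (X.filter fun x => m < f x).card ≤ X.card := by
  obtain rfl | hX := X.eq_empty_or_nonempty
  · simp
  let M := (X.image f).filter fun m => 2 * (X.filter fun x => f x < m).card ≤ X.card
  have hM : M.Nonempty := by
    obtain ⟨x, hx, hmin⟩ := X.exists_min_image f hX
    refine ⟨f x, Finset.mem_filter.mpr ⟨Finset.mem_image_of_mem f hx, ?_⟩⟩
    simp [Finset.filter_false_of_mem fun y hy => (hmin y hy).not_gt]
  obtain ⟨m, hm, hmax⟩ := M.exists_max_image id hM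
  refine ⟨m, (Finset.mem_filter.mp hm).2, ?_⟩
  by_contra! hlarge
  obtain ⟨x, hx, hmin⟩ := (X.filter fun x => m < f x).exists_min_image f
    (Finset.card_pos.mp (by omega))
  rw [Finset.mem_filter] at hx
  have hbelow : (X.filter fun y => f y < f x).card ≤ (X.filter fun y => ¬ m < f y).card := by
    refine Finset.card_le_card fun y hy => ?_
    rw [Finset.mem_filter] at hy ⊢
    exact ⟨hy.1, fun hmy => (hmin y (Finset.mem_filter.mpr ⟨hy.1, hmy⟩)).not_gt hy.2⟩
  have hsplit := Finset.card_filter_add_card_filter_not (s := X) fun y => m < f y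
  exact (hmax (f x) (Finset.mem_filter.mpr ⟨Finset.mem_image_of_mem f hx.1, by omega⟩)).not_gt hx.2

variable {ι α R : Type*} [LinearOrder R]

theorem exists_card_le_one_forall_exists_le (P : Finset ι) (f : ι → R) :
    ∃ F ⊆ P, F.card ≤ 1 ∧ ∀ q ∈ P, ∃ p ∈ F, f p ≤ f q := by
  obtain rfl | hP := P.eq_empty_or_nonempty
  · exact ⟨∅, by simp⟩
  · obtain ⟨p, hp, hmin⟩ := P.exists_min_image f hP
    exact ⟨{p}, by simpa, by simp, by simpa⟩

variable [Zero R]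

theorem sign_eq_sign_of_nonpos_iff_of_nonneg_iff {a b : R} (hle : a ≤ 0 ↔ b ≤ 0)
    (hge : 0 ≤ a ↔ 0 ≤ b) : SignType.sign a = SignType.sign b := by
  rcases lt_trichotomy a 0 with ha | rfl | ha
  · rw [sign_neg ha, sign_neg (not_le.mp (mt hge.mpr ha.not_ge))]
  · rw [le_antisymm (hle.mp le_rfl) (hge.mp le_rfl)]
  · rw [sign_pos ha, sign_pos (not_le.mp (mt hle.mpr ha.not_ge))]

/-- The two queries are the least element with prescribed sign `1` and the greatest one with
prescribed sign `-1` in the common order. -/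
theorem exists_card_le_two_forall_sign_eq {D : Finset ι} {X : Finset α} {v : α → ι → R}
    (hv : ∀ x ∈ X, ∀ y ∈ X, ∀ a ∈ D, ∀ b ∈ D, v x a ≤ v x b ↔ v y a ≤ v y b)
    {m : ι → SignType} (hm : ∀ q ∈ D, m q ≠ 0) :
    ∃ F ⊆ D, F.card ≤ 2 ∧ ∀ x ∈ X, (∀ q ∈ F, SignType.sign (v x q) = m q) →
      ∀ q ∈ D, SignType.sign (v x q) = m q := by
  classical
  obtain rfl | ⟨x₀, hx₀⟩ := X.eq_empty_or_nonempty
  · exact ⟨∅, by simp⟩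
  obtain ⟨F₁, hF₁, hcard₁, hpos⟩ := exists_card_le_one_forall_exists_le
    (D.filter fun q => m q = 1) (v x₀)
  obtain ⟨F₂, hF₂, hcard₂, hneg⟩ := exists_card_le_one_forall_exists_le
    (D.filter fun q => m q = -1) (fun q => OrderDual.toDual (v x₀ q))
  refine ⟨F₁ ∪ F₂, Finset.union_subset (hF₁.trans (Finset.filter_subset _ _))
    (hF₂.trans (Finset.filter_subset _ _)), (Finset.card_union_le _ _).trans (by omega),
    fun x hx hxm q hq => ?_⟩
  obtain hmq | hmq : m q = 1 ∨ m q = -1 := by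
    have hne := hm q hq
    revert hne; generalize m q = s; decide +revert
  · obtain ⟨p, hp, hpq⟩ := hpos q (Finset.mem_filter.mpr ⟨hq, hmq⟩)
    obtain ⟨hpD, hmp⟩ := Finset.mem_filter.mp (hF₁ hp)
    have hp0 := (hxm p (Finset.mem_union_left F₂ hp)).trans hmp
    rw [hmq, sign_eq_one_iff]
    exact (sign_eq_one_iff.mp hp0).trans_le ((hv x₀ hx₀ x hx p hpD q hq).mp hpq)
  · obtain ⟨p, hp, hpq⟩ := hneg q (Finset.mem_filter.mpr ⟨hq, hmq⟩)
    obtain ⟨hpD, hmp⟩ := Finset.mem_filter.mp (hF₂ hp)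
    have hp0 := (hxm p (Finset.mem_union_right F₁ hp)).trans hmp
    rw [hmq, sign_eq_neg_one_iff]
    exact ((hv x₀ hx₀ x hx q hq p hpD).mp hpq).trans_lt (sign_eq_neg_one_iff.mp hp0)

/-- If `v x z = 0`, then the order of `v x` determines all signs. -/
theorem exists_card_le_two_sign_eq (D : Finset ι) {X : Finset α} {v : α → ι → R}
    (hv : ∀ x ∈ X, ∀ y ∈ X, ∀ a ∈ D, ∀ b ∈ D, v x a ≤ v x b ↔ v y a ≤ v y b)
    (m : ι → SignType) :
    ∃ F ⊆ D, F.card ≤ 2 ∧ ∀ x ∈ X, ∀ y ∈ X, (∀ q ∈ F, SignType.sign (v x q) = m q) →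
      (∀ q ∈ F, SignType.sign (v y q) = m q) →
        ∀ q ∈ D, SignType.sign (v x q) = SignType.sign (v y q) := by
  by_cases hzero : ∃ z ∈ D, m z = 0
  · obtain ⟨z, hz, hmz⟩ := hzero
    refine ⟨{z}, by simpa, by simp, fun x hx y hy hxm hym q hq => ?_⟩
    simp only [Finset.mem_singleton, forall_eq, hmz, sign_eq_zero_iff] at hxm hym
    have hle := hv x hx y hy q hq z hz
    have hge := hv x hx y hy z hz q hq
    rw [hxm, hym] at hle hge
    exact sign_eq_sign_of_nonpos_iff_of_nonneg_iff hle hge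
  · push Not at hzero
    obtain ⟨F, hFD, hF, hsign⟩ := exists_card_le_two_forall_sign_eq hv hzero
    exact ⟨F, hFD, hF, fun x hx y hy hxm hym q hq =>
      (hsign x hx hxm q hq).trans (hsign y hy hym q hq).symm⟩

/-- Prescribing the median signs makes every deviation discard half of the candidates. -/
theorem exists_card_le_two_halving (D : Finset ι) {X : Finset α} {v : α → ι → R}
    (hv : ∀ x ∈ X, ∀ y ∈ X, ∀ a ∈ D, ∀ b ∈ D, v x a ≤ v x b ↔ v y a ≤ v y b) :
    ∃ F ⊆ D, F.card ≤ 2 ∧ ∀ Y ⊆ X, (∀ x ∈ Y, ∀ y ∈ Y, ∀ q ∈ F,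
        SignType.sign (v x q) = SignType.sign (v y q)) →
      2 * Y.card ≤ X.card ∨
        ∀ x ∈ Y, ∀ y ∈ Y, ∀ q ∈ D, SignType.sign (v x q) = SignType.sign (v y q) := by
  choose m hlt hgt using fun q => exists_median X fun x => SignType.sign (v x q)
  obtain ⟨F, hFD, hF, hsign⟩ := exists_card_le_two_sign_eq D hv m
  refine ⟨F, hFD, hF, fun Y hY hYF => or_iff_not_imp_left.mpr fun hcard => ?_⟩
  have hm (x : α) (hx : x ∈ Y) (q : ι) (hq : q ∈ F) : SignType.sign (v x q) = m q := by
    rcases lt_trichotomy (SignType.sign (v x q)) (m q) with h | h | h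
    · refine absurd ((Nat.mul_le_mul_left 2 (Finset.card_le_card fun y hy => ?_)).trans (hlt q))
        hcard
      exact Finset.mem_filter.mpr ⟨hY hy, hYF x hx y hy q hq ▸ h⟩
    · exact h
    · refine absurd ((Nat.mul_le_mul_left 2 (Finset.card_le_card fun y hy => ?_)).trans (hgt q))
        hcard
      exact Finset.mem_filter.mpr ⟨hY hy, hYF x hx y hy q hq ▸ h⟩
  exact fun x hx y hy => hsign x (hY hx) y (hY hy) (hm x hx) (hm y hy)

end Search

section Sorting

variable {n : ℕ} {Q A : Set (Vec n)} {X : Finset (Vec n)} {N N' : ℕ}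

theorem inner_le_inner_iff_of_signPattern_sub_eq {B : Set (Vec n)} {x y a b : Vec n}
    (h : signPattern (B - B) x = signPattern (B - B) y) (ha : a ∈ B) (hb : b ∈ B) :
    inner ℝ x a ≤ inner ℝ x b ↔ inner ℝ y a ≤ inner ℝ y b := by
  have hsign := signPattern_eq_iff.mp h (b - a) (Set.sub_mem_sub hb ha)
  rw [← sub_nonneg, ← inner_sub_right, ← sign_nonneg_iff, hsign, sign_nonneg_iff,
    inner_sub_right, sub_nonneg]

theorem signPattern_insert_sub_insert_eq {B : Set (Vec n)} {x y h : Vec n}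
    (hB : signPattern (B - B) x = signPattern (B - B) y)
    (hh : ∀ b ∈ B, SignType.sign (inner ℝ x (h - b)) = SignType.sign (inner ℝ y (h - b))) :
    signPattern (insert h B - insert h B) x = signPattern (insert h B - insert h B) y := by
  refine signPattern_eq_iff.mpr fun q hq => ?_
  obtain ⟨a, rfl | ha, b, rfl | hb, rfl⟩ := Set.mem_sub.mp hq
  · simp
  · exact hh b hb
  · rw [← neg_sub, inner_neg_right, inner_neg_right, Left.sign_neg, Left.sign_neg, hh a ha]
  · exact signPattern_eq_iff.mp hB _ (Set.sub_mem_sub ha hb)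

/-- Some decision tree with queries in `Q` maps every input `x` in `X` to a point with the same
sign pattern on `A` as `x`, and its number of queries is at most the binary logarithm of `N`. The
budget is kept in exponential form so that it can be compared with the number of candidates. -/
def Locatable (Q A : Set (Vec n)) (X : Finset (Vec n)) (N : ℕ) : Prop :=
  ∃ T : LinearDecisionTree n (Vec n), T.QueriesIn Q ∧
    ∀ x ∈ X, signPattern A (T.eval x) = signPattern A x ∧ 2 ^ T.numQueries x ≤ N

namespace Locatable

theorem mono (h : Locatable Q A X N) (hN : N ≤ N') : Locatable Q A X N' := by
  obtain ⟨T, hT, hX⟩ := h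
  exact ⟨T, hT, fun x hx => ⟨(hX x hx).1, (hX x hx).2.trans hN⟩⟩

theorem of_signPattern_eq (h : ∀ x ∈ X, ∀ y ∈ X, signPattern A x = signPattern A y) :
    Locatable Q A X (X.card ^ 2) := by
  obtain rfl | ⟨x₀, hx₀⟩ := X.eq_empty_or_nonempty
  · exact ⟨.leaf 0, trivial, by simp⟩
  · exact ⟨.leaf x₀, trivial, fun x hx =>
      ⟨h x₀ hx₀ x hx, Nat.one_le_pow _ _ (Finset.card_pos.mpr ⟨x₀, hx₀⟩)⟩⟩

theorem of_partition {F : Finset (Vec n)} (hF : (F : Set (Vec n)) ⊆ Q)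
    (h : ∀ Y ⊆ X, (∀ x ∈ Y, ∀ y ∈ Y, ∀ q ∈ F,
      SignType.sign (inner ℝ x q) = SignType.sign (inner ℝ y q)) → Locatable Q A Y N) :
    Locatable Q A X (2 ^ F.card * N) := by
  classical
  let part (s : Vec n → SignType) := X.filter fun x => ∀ q ∈ F, SignType.sign (inner ℝ x q) = s q
  have hpart (s : Vec n → SignType) : Locatable Q A (part s) N :=
    h _ (Finset.filter_subset _ _) fun x hx y hy q hq =>
      ((Finset.mem_filter.mp hx).2 q hq).trans ((Finset.mem_filter.mp hy).2 q hq).symm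
  choose k hk hkX using hpart
  obtain ⟨T, hT, hTx⟩ := LinearDecisionTree.exists_eval_eq_sign F
  refine ⟨T.bind k, (hT.mono hF).bind hk, fun x hx => ?_⟩
  have hxpart : x ∈ part (T.eval x) :=
    Finset.mem_filter.mpr ⟨hx, fun q hq => ((hTx x).1 q hq).symm⟩
  obtain ⟨hagree, hcost⟩ := hkX _ x hxpart
  rw [LinearDecisionTree.eval_bind, LinearDecisionTree.numQueries_bind, (hTx x).2, pow_add]
  exact ⟨hagree, Nat.mul_le_mul_left _ hcost⟩

/-- Two queries cost a factor `4`, which is what `X.card ^ 2` loses when `X` is halved. -/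
theorem of_insert {B : Set (Vec n)} (hB : B.Finite) {h : Vec n} (hQ : ∀ b ∈ B, h - b ∈ Q)
    (hX : ∀ x ∈ X, ∀ y ∈ X, signPattern (B - B) x = signPattern (B - B) y)
    (hnext : ∀ Y ⊆ X, (∀ x ∈ Y, ∀ y ∈ Y, signPattern (insert h B - insert h B) x =
      signPattern (insert h B - insert h B) y) → Locatable Q A Y (N * Y.card ^ 2)) :
    Locatable Q A X (4 * (N * X.card ^ 2)) := by
  classical
  induction hcard : X.card using Nat.strong_induction_on generalizing X with
  | _ c ih =>
    subst hcard
    obtain rfl | hne := X.eq_empty_or_nonempty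
    · exact (of_signPattern_eq (by simp)).mono (by simp)
    obtain ⟨F, hFD, hF, hhalf⟩ := exists_card_le_two_halving (X := X)
      (v := fun x b => inner ℝ x (h - b)) hB.toFinset fun x hx y hy a ha b hb => by
        rw [Set.Finite.mem_toFinset] at ha hb
        simpa only [inner_sub_right, sub_le_sub_iff_left] using
          inner_le_inner_iff_of_signPattern_sub_eq (hX x hx y hy) hb ha
    refine (of_partition (F := F.image (h - ·)) (N := N * X.card ^ 2) ?_
      fun Y hY hYF => ?_).mono ?_
    · intro q hq
      obtain ⟨b, hb, rfl⟩ := Finset.mem_image.mp hq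
      exact hQ b (hB.mem_toFinset.mp (hFD hb))
    · have hYX : ∀ x ∈ Y, ∀ y ∈ Y, signPattern (B - B) x = signPattern (B - B) y :=
        fun x hx y hy => hX x (hY hx) y (hY hy)
      obtain hsmall | hagree := hhalf Y hY fun x hx y hy q hq =>
        hYF x hx y hy _ (Finset.mem_image_of_mem _ hq)
      · refine (ih Y.card (by have := hne.card_pos; omega) hYX
          (fun Z hZ => hnext Z (hZ.trans hY)) rfl).mono ?_
        calc 4 * (N * Y.card ^ 2) = N * (2 * Y.card) ^ 2 := by ring
          _ ≤ N * X.card ^ 2 := by gcongr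
      · refine (hnext Y hY fun x hx y hy => signPattern_insert_sub_insert_eq (hYX x hx y hy)
          fun b hb => hagree x hx y hy b (hB.mem_toFinset.mpr hb)).mono ?_
        gcongr
    · gcongr
      calc 2 ^ (F.image (h - ·)).card ≤ 2 ^ 2 :=
            Nat.pow_le_pow_right two_pos (Finset.card_image_le.trans hF)
        _ = 4 := by norm_num

theorem sort {B : Set (Vec n)} (hB : B.Finite) (R : Finset (Vec n))
    (hQ : (R : Set (Vec n)) - (B ∪ R) ⊆ Q)
    (hX : ∀ x ∈ X, ∀ y ∈ X, signPattern (B - B) x = signPattern (B - B) y) :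
    Locatable Q (B ∪ R - (B ∪ R)) X (4 ^ R.card * X.card ^ 2) := by
  classical
  induction R using Finset.induction_on generalizing B X with
  | empty => simpa using of_signPattern_eq hX
  | insert h R hR ih =>
    have hunion : B ∪ ((insert h R : Finset (Vec n)) : Set (Vec n)) =
        insert h B ∪ R := by
      rw [Finset.coe_insert, Set.union_insert, Set.insert_union]
    rw [hunion] at hQ ⊢
    rw [Finset.card_insert_of_notMem hR, pow_succ', mul_assoc]
    refine of_insert hB (fun b hb => hQ (Set.sub_mem_sub (by simp) (by simp [hb]))) hX
      fun Y _ hY => ih (hB.insert h) ?_ hY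
    exact (Set.sub_subset_sub_right (by simp)).trans hQ

end Locatable

/-- A comparison tree for `S` that finds a point in the cell of the input, and hence knows the
signs and the order of the values of the elements of `S`. -/
def IsSortingTree (S : Set (Vec n)) (T : LinearDecisionTree n (Vec n)) : Prop :=
  T.IsComparison S ∧ ∀ x, T.eval x ∈ cell S x

theorem exists_isSortingTree (S : Finset (Vec n)) :
    ∃ T : LinearDecisionTree n (Vec n), IsSortingTree (S : Set (Vec n)) T ∧
      ∀ x, 2 ^ T.numQueries x ≤ 4 ^ S.card * ((2 * (S.card + 1) ^ 2 + 1) ^ n) ^ 2 := by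
  classical
  let D := insert 0 S - insert 0 S
  have hSD : (S : Set (Vec n)) ∪ (S - S) ⊆ D := by
    have hS : (S : Set (Vec n)) ⊆ (insert 0 S : Finset (Vec n)) := by simp
    rw [Finset.coe_sub]
    refine Set.union_subset (fun s hs => ?_) (Set.sub_subset_sub hS hS)
    exact Set.mem_sub.mpr ⟨s, hS hs, 0, by simp, sub_zero s⟩
  have hD : D.card ≤ (S.card + 1) ^ 2 := by
    calc D.card ≤ (insert 0 S).card * (insert 0 S).card := Finset.card_sub_le
      _ ≤ (S.card + 1) * (S.card + 1) := by gcongr <;> exact Finset.card_insert_le _ _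
      _ = (S.card + 1) ^ 2 := (sq _).symm
  obtain ⟨X, hX, hXrep⟩ := exists_finset_forall_exists_signPattern_eq D
  have hQ : (S : Set (Vec n)) - ({0} ∪ (S : Set (Vec n))) ⊆ (S : Set (Vec n)) ∪ (S - S) := by
    intro q hq
    obtain ⟨s, hs, b, rfl | hb, rfl⟩ := Set.mem_sub.mp hq
    · exact Or.inl (by simpa)
    · exact Or.inr (Set.sub_mem_sub hs hb)
  obtain ⟨T, hT, hTX⟩ := Locatable.sort (X := X) (Set.finite_singleton 0) S hQ
    fun x _ y _ => by simp [signPattern_eq_iff]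
  rw [Set.singleton_union, ← Finset.coe_insert, ← Finset.coe_sub] at hTX
  have hrep (x : Vec n) : T.eval x ∈ cell (S : Set (Vec n)) x ∧
      2 ^ T.numQueries x ≤ 4 ^ S.card * X.card ^ 2 := by
    obtain ⟨y, hy, hyx⟩ := hXrep x
    have hTy := signPattern_eq_mono hSD hyx
    rw [← hT.eval_eq hTy, ← hT.numQueries_eq hTy]
    exact ⟨signPattern_eq_mono hSD ((hTX y hy).1.trans hyx), (hTX y hy).2⟩
  refine ⟨T, ⟨hT, fun x => (hrep x).1⟩, fun x => (hrep x).2.trans ?_⟩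
  gcongr
  exact hX.trans (by gcongr)

theorem le_of_two_pow_le_sorting_bound {n d m q : ℕ} (hd : 2 ≤ d) (hm : m ≤ 2 * d)
    (hq : 2 ^ q ≤ 4 ^ m * ((2 * (m + 1) ^ 2 + 1) ^ n) ^ 2) :
    (q : ℝ) ≤ 24 * (d + n * Real.log d) := by
  have hcells : 2 * (m + 1) ^ 2 + 1 ≤ d ^ 6 := by
    calc 2 * (m + 1) ^ 2 + 1 ≤ 2 * (2 * d + 1) ^ 2 + 1 := by gcongr
      _ ≤ d ^ 2 * 2 ^ 4 := by nlinarith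
      _ ≤ d ^ 2 * d ^ 4 := by gcongr
      _ = d ^ 6 := by ring
  have hpow : (2 : ℝ) ^ q ≤ 2 ^ (4 * d) * (d : ℝ) ^ (12 * n) := by
    norm_cast
    calc 2 ^ q ≤ 4 ^ (2 * d) * ((d ^ 6) ^ n) ^ 2 := hq.trans (by gcongr; norm_num)
      _ = 2 ^ (4 * d) * d ^ (12 * n) := by
        rw [show 4 = 2 ^ 2 by rfl, ← pow_mul, ← pow_mul, ← pow_mul]
        ring_nf
  have hd0 : (0 : ℝ) < d := by positivity
  have hlog := Real.log_le_log (by positivity) hpow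
  rw [Real.log_mul (by positivity) (by positivity), Real.log_pow, Real.log_pow, Real.log_pow]
    at hlog
  push_cast at hlog
  have hlog2 : 1 / 2 ≤ Real.log 2 := by linarith [Real.log_two_gt_d9]
  have hnlog : 0 ≤ n * Real.log d :=
    mul_nonneg n.cast_nonneg (Real.log_nonneg (by exact_mod_cast one_le_two.trans hd))
  nlinarith

end Sorting

section Sampling

variable {α : Type*}

/-- The samples of size `m` from `s`; if `s` is smaller than that, the only sample is `s`. -/
def samples (s : Finset α) (m : ℕ) : Finset (Finset α) :=
  s.powersetCard (min m s.card)

theorem mem_samples {s t : Finset α} {m : ℕ} :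
    t ∈ samples s m ↔ t ⊆ s ∧ t.card = min m s.card :=
  Finset.mem_powersetCard

theorem samples_nonempty (s : Finset α) (m : ℕ) : (samples s m).Nonempty :=
  Finset.powersetCard_nonempty.mpr (min_le_right _ _)

theorem sum_powersetCard_sum_sdiff {M : Type*} [DecidableEq α] [AddCommMonoid M] (s : Finset α)
    (m : ℕ) (f : Finset α → α → M) :
    ∑ t ∈ s.powersetCard m, ∑ a ∈ s \ t, f t a =
      ∑ u ∈ s.powersetCard (m + 1), ∑ a ∈ u, f (u.erase a) a := by
  rw [Finset.sum_sigma', Finset.sum_sigma']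
  refine Finset.sum_nbij' (fun p => ⟨insert p.2 p.1, p.2⟩) (fun p => ⟨p.1.erase p.2, p.2⟩)
    ?_ ?_ ?_ ?_ ?_ <;> rintro ⟨t, a⟩ hp <;>
    simp only [Finset.mem_sigma, Finset.mem_powersetCard, Finset.mem_sdiff] at hp ⊢
  · obtain ⟨⟨hts, rfl⟩, has, hat⟩ := hp
    exact ⟨⟨Finset.insert_subset has hts, Finset.card_insert_of_notMem hat⟩,
      Finset.mem_insert_self a t⟩
  · obtain ⟨⟨hts, hcard⟩, hat⟩ := hp
    exact ⟨⟨(Finset.erase_subset a t).trans hts, by rw [Finset.card_erase_of_mem hat, hcard]; rfl⟩,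
      hts hat, Finset.notMem_erase a t⟩
  · rw [Finset.erase_insert hp.2.2]
  · rw [Finset.insert_erase hp.2]
  · rw [Finset.erase_insert hp.2.2]

end Sampling

section Inference

variable {n d : ℕ} {H S S' : Set (Vec n)} {G U : Finset (Vec n)} {h x y : Vec n}

theorem infers_of_mem (hh : h ∈ S) : Infers S h x :=
  fun _ hx' => signPattern_eq_iff.mp hx' h (Or.inl hh)

theorem Infers.mono (hS : Infers S h x) (hSS' : S ⊆ S') : Infers S' h x := fun x' hx' =>
  hS x' (signPattern_eq_mono (Set.union_subset_union hSS' (Set.sub_subset_sub hSS' hSS')) hx')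

theorem infers_congr (hxy : y ∈ cell S x) : Infers S h y ↔ Infers S h x := by
  have hcell : cell S y = cell S x :=
    Set.ext fun z => ⟨fun hz => hz.trans hxy, fun hz => hz.trans hxy.symm⟩
  constructor
  · intro hy x' hx'
    rw [hy x' (hcell ▸ hx'), hy x hxy.symm]
  · intro hx x' hx'
    rw [hx x' (hcell ▸ hx'), hx y hxy]

/-- The inference dimension of `H` is at most `d`, i.e. `d` has the property whose least witness is
the inference dimension (see `IsInferenceDimension`). -/
def InferenceDimensionLE (H : Set (Vec n)) (d : ℕ) : Prop :=
  ∀ S ⊆ H, (d : ℕ∞) ≤ S.encard → ∀ x, ∃ h ∈ S, Infers (S \ {h}) h x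

namespace InferenceDimensionLE

theorem pos (hd : InferenceDimensionLE H d) : 0 < d := by
  by_contra! hd0
  obtain ⟨h, hh, -⟩ := hd ∅ (Set.empty_subset H) (by simp [Nat.le_zero.mp hd0]) 0
  exact hh

/-- At the origin, the empty set infers only the zero vector. -/
theorem two_le {H : Finset (Vec n)} (hd : InferenceDimensionLE (H : Set (Vec n)) d)
    (hH : 2 ≤ H.card) : 2 ≤ d := by
  by_contra! hd2
  have hzero (a : Vec n) (ha : a ∈ H) : a = 0 := by
    obtain ⟨b, rfl, hinf⟩ := hd {a} (by simpa) (by simp; omega) 0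
    have hsign := hinf b (by simp [cell, signPattern_eq_iff])
    rw [inner_zero_left, sign_zero, sign_eq_zero_iff] at hsign
    exact inner_self_eq_zero.mp hsign
  obtain ⟨a, ha, b, hb, hab⟩ := Finset.one_lt_card.mp hH
  exact hab ((hzero a ha).trans (hzero b hb).symm)

open Classical in
theorem card_filter_not_infers_lt (hd : InferenceDimensionLE H d) (hU : (U : Set (Vec n)) ⊆ H)
    (x : Vec n) : (U.filter fun h => ¬ Infers (↑U \ {h}) h x).card < d := by
  by_contra! hcard
  let V := U.filter fun h => ¬ Infers (↑U \ {h}) h x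
  have hVU : (V : Set (Vec n)) ⊆ U := Finset.coe_subset.mpr (Finset.filter_subset _ _)
  obtain ⟨h, hh, hinf⟩ := hd V (hVU.trans hU)
    (by rw [Set.encard_coe_eq_coe_finsetCard]; exact Nat.cast_le.mpr hcard) x
  exact (Finset.mem_filter.mp (Finset.mem_coe.mp hh)).2
    (hinf.mono (Set.sdiff_subset_sdiff_left hVU))

end InferenceDimensionLE

open Classical in
/-- The elements of `G` whose sign at `x` is not inferred by `S`. -/
noncomputable def notInferred (G : Finset (Vec n)) (S : Set (Vec n)) (x : Vec n) :
    Finset (Vec n) :=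
  G.filter fun h => ¬ Infers S h x

theorem mem_notInferred : h ∈ notInferred G S x ↔ h ∈ G ∧ ¬ Infers S h x := by
  simp [notInferred]

theorem notInferred_congr (hxy : y ∈ cell S x) : notInferred G S y = notInferred G S x := by
  ext h
  rw [mem_notInferred, mem_notInferred, infers_congr hxy]

theorem notInferred_ssubset (hh : h ∈ G) (hS : h ∈ S) : notInferred G S x ⊂ G :=
  (Finset.ssubset_iff_of_subset fun _ ha => (mem_notInferred.mp ha).1).mpr
    ⟨h, hh, fun ha => (mem_notInferred.mp ha).2 (infers_of_mem hS)⟩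

namespace InferenceDimensionLE

theorem sum_card_notInferred_le (hd : InferenceDimensionLE H d) (hG : (G : Set (Vec n)) ⊆ H)
    (m : ℕ) (x : Vec n) :
    ∑ S ∈ G.powersetCard m, (notInferred G S x).card ≤ G.card.choose (m + 1) * d := by
  classical
  have hsdiff (S : Finset (Vec n)) :
      notInferred G S x = (G \ S).filter fun h => ¬ Infers (S : Set (Vec n)) h x := by
    ext h
    rw [mem_notInferred, Finset.mem_filter, Finset.mem_sdiff]
    exact ⟨fun hh => ⟨⟨hh.1, fun hS => hh.2 (infers_of_mem hS)⟩, hh.2⟩, fun hh => ⟨hh.1.1, hh.2⟩⟩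
  calc ∑ S ∈ G.powersetCard m, (notInferred G S x).card
      = ∑ U ∈ G.powersetCard (m + 1), (U.filter fun h => ¬ Infers (↑U \ {h}) h x).card := by
        simp only [hsdiff, Finset.card_filter, sum_powersetCard_sum_sdiff, Finset.coe_erase]
    _ ≤ (G.powersetCard (m + 1)).card * d :=
        Finset.sum_le_card_nsmul _ _ _ fun U hU => (hd.card_filter_not_infers_lt
          ((Finset.coe_subset.mpr (Finset.mem_powersetCard.mp hU).1).trans hG) x).le
    _ = G.card.choose (m + 1) * d := by rw [Finset.card_powersetCard]

theorem two_mul_sum_card_notInferred_le (hd : InferenceDimensionLE H d)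
    (hG : (G : Set (Vec n)) ⊆ H) (x : Vec n) :
    2 * ∑ S ∈ samples G (2 * d), (notInferred G S x).card ≤
      (samples G (2 * d)).card * G.card := by
  rw [samples]
  rcases le_total G.card (2 * d) with hle | hle
  · have hempty : notInferred G G x = ∅ := Finset.eq_empty_of_forall_notMem fun h hh =>
      (mem_notInferred.mp hh).2 (infers_of_mem (mem_notInferred.mp hh).1)
    simp [min_eq_right hle, Finset.powersetCard_self, hempty]
  · rw [min_eq_left hle, Finset.card_powersetCard]
    have hchoose := Nat.choose_succ_right_eq G.card (2 * d)
    refine Nat.le_of_mul_le_mul_left ?_ (Nat.succ_pos (2 * d))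
    calc (2 * d + 1) * (2 * ∑ S ∈ G.powersetCard (2 * d), (notInferred G S x).card)
        ≤ (2 * d + 1) * (2 * (G.card.choose (2 * d + 1) * d)) := by
          gcongr
          exact hd.sum_card_notInferred_le hG (2 * d) x
      _ = (G.card.choose (2 * d + 1) * (2 * d + 1)) * (2 * d) := by ring
      _ = (G.card.choose (2 * d) * (G.card - 2 * d)) * (2 * d) := by rw [hchoose]
      _ ≤ (G.card.choose (2 * d) * G.card) * (2 * d + 1) := by gcongr <;> omega
      _ = (2 * d + 1) * (G.card.choose (2 * d) * G.card) := mul_comm _ _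

end InferenceDimensionLE

end Inference

section Logarithm

theorem log_one_add_half_le {N : ℝ} (hN : 1 ≤ N) :
    Real.log (1 + N / 2) ≤ Real.log (1 + N) - 1 / 4 := by
  have hratio : (1 + N / 2) / (1 + N) ≤ 3 / 4 := by
    rw [div_le_iff₀ (by linarith)]
    linarith
  have hlog := Real.log_le_sub_one_of_pos (div_pos (by linarith : 0 < 1 + N / 2)
    (by linarith : 0 < 1 + N))
  rw [Real.log_div (by linarith) (by linarith)] at hlog
  linarith

theorem inv_card_mul_sum_log_le_log {ι : Type*} {s : Finset ι} (hs : s.Nonempty) {f : ι → ℝ}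
    (hf : ∀ i ∈ s, 0 < f i) :
    (s.card : ℝ)⁻¹ * ∑ i ∈ s, Real.log (f i) ≤ Real.log ((s.card : ℝ)⁻¹ * ∑ i ∈ s, f i) := by
  have hcard : (s.card : ℝ) ≠ 0 := Nat.cast_ne_zero.mpr hs.card_pos.ne'
  simpa only [smul_eq_mul, Finset.mul_sum] using
    strictConcaveOn_log_Ioi.concaveOn.le_map_sum (t := s) (w := fun _ => (s.card : ℝ)⁻¹) (p := f)
      (fun _ _ => by positivity) (by rw [Finset.sum_const, nsmul_eq_mul, mul_inv_cancel₀ hcard]) hf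

theorem inv_card_mul_sum_log_one_add_le {ι : Type*} {s : Finset ι} (hs : s.Nonempty) {f : ι → ℕ}
    {N : ℕ} (hN : 1 ≤ N) (hf : 2 * ∑ i ∈ s, f i ≤ s.card * N) :
    (s.card : ℝ)⁻¹ * ∑ i ∈ s, Real.log (1 + f i) ≤ Real.log (1 + N) - 1 / 4 := by
  have hcard : (0 : ℝ) < s.card := Nat.cast_pos.mpr hs.card_pos
  have hf' : 2 * ∑ i ∈ s, (f i : ℝ) ≤ s.card * N := by exact_mod_cast hf
  calc (s.card : ℝ)⁻¹ * ∑ i ∈ s, Real.log (1 + f i)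
      ≤ Real.log ((s.card : ℝ)⁻¹ * ∑ i ∈ s, (1 + (f i : ℝ))) :=
        inv_card_mul_sum_log_le_log hs fun i _ => by positivity
    _ ≤ Real.log (1 + N / 2) := by
        refine Real.log_le_log (by positivity) ?_
        rw [inv_mul_le_iff₀ hcard, Finset.sum_add_distrib, Finset.sum_const, nsmul_one]
        linarith
    _ ≤ Real.log (1 + N) - 1 / 4 := log_one_add_half_le (by exact_mod_cast hN)

theorem log_one_add_le_two_mul_log {N : ℝ} (hN : 2 ≤ N) :
    Real.log (1 + N) ≤ 2 * Real.log N := by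
  rw [← Real.log_rpow (by linarith)]
  norm_cast
  exact Real.log_le_log (by linarith) (by nlinarith)

end Logarithm

section Expectation

variable {α β : Type*}

/-- The expectation of a nonnegative function under a discrete distribution. -/
noncomputable def expectation (μ : PMF α) (f : α → ℝ≥0∞) : ℝ≥0∞ := ∑' a, μ a * f a

theorem expectation_pure (a : α) (f : α → ℝ≥0∞) : expectation (PMF.pure a) f = f a := by
  classical
  rw [expectation, tsum_eq_single a fun b hb => by simp [PMF.pure_apply, hb]]
  simp

theorem expectation_bind (μ : PMF α) (k : α → PMF β) (f : β → ℝ≥0∞) :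
    expectation (μ.bind k) f = expectation μ fun a => expectation (k a) f := by
  simp only [expectation, PMF.bind_apply, ← ENNReal.tsum_mul_right, ← ENNReal.tsum_mul_left]
  rw [ENNReal.tsum_comm]
  simp only [mul_assoc]

theorem expectation_map (μ : PMF α) (g : α → β) (f : β → ℝ≥0∞) :
    expectation (μ.map g) f = expectation μ (f ∘ g) := by
  rw [← PMF.bind_pure_comp, expectation_bind]
  simp only [Function.comp_def, expectation_pure]

theorem expectation_const (μ : PMF α) (c : ℝ≥0∞) : expectation μ (fun _ => c) = c := by
  rw [expectation, ENNReal.tsum_mul_right, PMF.tsum_coe, one_mul]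

theorem expectation_add (μ : PMF α) (f g : α → ℝ≥0∞) :
    expectation μ (fun a => f a + g a) = expectation μ f + expectation μ g := by
  simp only [expectation, mul_add, ENNReal.tsum_add]

theorem expectation_mono (μ : PMF α) {f g : α → ℝ≥0∞} (h : ∀ a ∈ μ.support, f a ≤ g a) :
    expectation μ f ≤ expectation μ g := by
  refine ENNReal.tsum_le_tsum fun a => ?_
  by_cases ha : a ∈ μ.support
  · gcongr
    exact h a ha
  · simp [μ.apply_eq_zero_iff a |>.mpr ha]

theorem expectation_uniformOfFinset (s : Finset α) (hs : s.Nonempty) (f : α → ℝ≥0∞) :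
    expectation (PMF.uniformOfFinset s hs) f = (s.card : ℝ≥0∞)⁻¹ * ∑ a ∈ s, f a := by
  rw [expectation, tsum_eq_sum fun a ha => by
    rw [PMF.uniformOfFinset_apply_of_notMem hs ha, zero_mul], Finset.mul_sum]
  exact Finset.sum_congr rfl fun a ha => by rw [PMF.uniformOfFinset_apply_of_mem hs ha]

theorem expectation_uniformOfFinset_ofReal (s : Finset α) (hs : s.Nonempty) {f : α → ℝ}
    (hf : ∀ a ∈ s, 0 ≤ f a) :
    expectation (PMF.uniformOfFinset s hs) (fun a => ENNReal.ofReal (f a)) =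
      ENNReal.ofReal ((s.card : ℝ)⁻¹ * ∑ a ∈ s, f a) := by
  rw [expectation_uniformOfFinset, ← ENNReal.ofReal_sum_of_nonneg hf,
    ENNReal.ofReal_mul (by positivity), ENNReal.ofReal_inv_of_pos (Nat.cast_pos.mpr hs.card_pos),
    ENNReal.ofReal_natCast]

end Expectation

namespace LinearDecisionTree

variable {n : ℕ} {α β : Type} {Q : Set (Vec n)}

/-- Sequential composition with a random continuation: a leaf with output `a` is replaced by a
random tree drawn from `k a`, independently for distinct leaves. -/
noncomputable def randomBind (k : α → PMF (LinearDecisionTree n β)) :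
    LinearDecisionTree n α → PMF (LinearDecisionTree n β)
  | leaf a => k a
  | node q child =>
      (randomBind k (child (-1))).bind fun T₁ => (randomBind k (child 0)).bind fun T₂ =>
        (randomBind k (child 1)).map fun T₃ => node q fun s => SignType.casesOn s T₂ T₁ T₃

theorem exists_of_mem_support_randomBind_node {k : α → PMF (LinearDecisionTree n β)} {q : Vec n}
    {child : SignType → LinearDecisionTree n α} {T : LinearDecisionTree n β}
    (hT : T ∈ ((node q child).randomBind k).support) :
    ∃ child', T = node q child' ∧ ∀ s, child' s ∈ ((child s).randomBind k).support := by
  simp only [randomBind, PMF.mem_support_bind_iff, PMF.mem_support_map_iff] at hT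
  obtain ⟨T₁, h₁, T₂, h₂, T₃, h₃, rfl⟩ := hT
  refine ⟨_, rfl, fun s => ?_⟩
  cases s
  exacts [h₂, h₁, h₃]

theorem QueriesIn.randomBind {k : α → PMF (LinearDecisionTree n β)}
    (hk : ∀ a, ∀ T' ∈ (k a).support, T'.QueriesIn Q) {T : LinearDecisionTree n α}
    (hT : T.QueriesIn Q) : ∀ T' ∈ (T.randomBind k).support, T'.QueriesIn Q := by
  induction T with
  | leaf a => exact hk a
  | node q child ih =>
    intro T' hT'
    obtain ⟨child', rfl, hchild'⟩ := exists_of_mem_support_randomBind_node hT'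
    exact ⟨hT.1, fun s => ih s (hT.2 s) _ (hchild' s)⟩

theorem exists_eval_eq_of_mem_support_randomBind {k : α → PMF (LinearDecisionTree n β)}
    {T : LinearDecisionTree n α} (x : Vec n) :
    ∀ T' ∈ (T.randomBind k).support, ∃ T'' ∈ (k (T.eval x)).support, T'.eval x = T''.eval x := by
  induction T with
  | leaf a => exact fun T' hT' => ⟨T', hT', rfl⟩
  | node q child ih =>
    intro T' hT'
    obtain ⟨child', rfl, hchild'⟩ := exists_of_mem_support_randomBind_node hT'
    exact ih _ (child' _) (hchild' (SignType.sign (inner ℝ q x)))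

/-- The expected number of queries of a random decision tree on input `x`. -/
noncomputable def expectedNumQueries (μ : PMF (LinearDecisionTree n α)) (x : Vec n) : ℝ≥0∞ :=
  expectation μ fun T => (T.numQueries x : ℝ≥0∞)

theorem expectedNumQueries_map_map (μ : PMF (LinearDecisionTree n α)) (f : α → β) (x : Vec n) :
    expectedNumQueries (μ.map (map f)) x = expectedNumQueries μ x := by
  simp only [expectedNumQueries, expectation_map, Function.comp_def, numQueries_map]

theorem expectedNumQueries_randomBind (k : α → PMF (LinearDecisionTree n β))
    (T : LinearDecisionTree n α) (x : Vec n) :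
    expectedNumQueries (T.randomBind k) x =
      T.numQueries x + expectedNumQueries (k (T.eval x)) x := by
  induction T with
  | leaf a => simp [randomBind, eval, numQueries]
  | node q child ih =>
    simp only [eval, numQueries, Nat.cast_add, Nat.cast_one]
    rw [add_right_comm, ← ih]
    simp only [expectedNumQueries, randomBind, expectation_bind, expectation_map,
      Function.comp_def, numQueries, Nat.cast_add, Nat.cast_one]
    cases SignType.sign (inner ℝ q x) <;> simp only [expectation_add, expectation_const] <;> rfl

end LinearDecisionTree

section Labeling

open LinearDecisionTree

variable {n d : ℕ} {H : Set (Vec n)} {S G : Finset (Vec n)}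
  {T : LinearDecisionTree n (Vec n)}
  {μ : Finset (Vec n) → PMF (LinearDecisionTree n (Vec n → SignType))}

/-- A random comparison tree for `H` that always finds the signs of the elements of `G`; the labels
of other vectors are arbitrary. -/
def IsRandomLabeling (H : Set (Vec n)) (G : Finset (Vec n))
    (μ : PMF (LinearDecisionTree n (Vec n → SignType))) : Prop :=
  ∀ T ∈ μ.support, T.IsComparison H ∧ ∀ x, ∀ h ∈ G, T.eval x h = SignType.sign (inner ℝ x h)

theorem IsRandomLabeling.bind {ι : Type*} {ν : PMF ι}
    {k : ι → PMF (LinearDecisionTree n (Vec n → SignType))}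
    (h : ∀ i ∈ ν.support, IsRandomLabeling H G (k i)) : IsRandomLabeling H G (ν.bind k) := by
  intro T hT
  obtain ⟨i, hi, hTi⟩ := (PMF.mem_support_bind_iff _ _ _).mp hT
  exact h i hi T hTi

theorem IsRandomLabeling.exists_zeroErrorComparisonTree {G : Finset (Vec n)}
    {μ : PMF (LinearDecisionTree n (Vec n → SignType))}
    (hμ : IsRandomLabeling (G : Set (Vec n)) G μ) :
    ∃ R : ZeroErrorComparisonTree (G : Set (Vec n)),
      ∀ x, R.expectedQueries x = expectedNumQueries μ x := by
  refine ⟨⟨μ.map (map fun g h => g h), ?_, ?_⟩, expectedNumQueries_map_map μ _⟩ <;>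
    intro T hT <;> obtain ⟨T₀, hT₀, rfl⟩ := (PMF.mem_support_map_iff _ _ _).mp hT
  · exact (hμ T₀ hT₀).1.map _
  · exact fun x => (eval_map _ _ _).trans (funext fun h => (hμ T₀ hT₀).2 x h h.2)

open Classical in
/-- One round of the algorithm: locate the cell of the input for `S` with the tree `T`, continue
with the random tree `μ R` for the set `R` of elements that `S` does not infer there, and fill in
the inferred signs. -/
noncomputable def samplingRound (T : LinearDecisionTree n (Vec n)) (G S : Finset (Vec n))
    (μ : Finset (Vec n) → PMF (LinearDecisionTree n (Vec n → SignType))) :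
    PMF (LinearDecisionTree n (Vec n → SignType)) :=
  T.randomBind fun y => (μ (notInferred G S y)).map (map fun g h =>
    if Infers (S : Set (Vec n)) h y then SignType.sign (inner ℝ y h) else g h)

theorem isRandomLabeling_samplingRound (hT : IsSortingTree (S : Set (Vec n)) T)
    (hS : (S : Set (Vec n)) ⊆ H)
    (hμ : ∀ y, IsRandomLabeling H (notInferred G S y) (μ (notInferred G S y))) :
    IsRandomLabeling H G (samplingRound T G S μ) := by
  intro T' hT'
  constructor
  · refine QueriesIn.randomBind (fun y T'' hT'' => ?_) (hT.1.mono hS) T' hT'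
    obtain ⟨T₀, hT₀, rfl⟩ := (PMF.mem_support_map_iff _ _ _).mp hT''
    exact (hμ y T₀ hT₀).1.map _
  · intro x h hh
    obtain ⟨T'', hT'', heval⟩ := exists_eval_eq_of_mem_support_randomBind x T' hT'
    obtain ⟨T₀, hT₀, rfl⟩ := (PMF.mem_support_map_iff _ _ _).mp hT''
    rw [heval, eval_map]
    split_ifs with hinf
    · exact (infers_congr (hT.2 x)).mp hinf _ (hT.2 x)
    · exact (hμ _ T₀ hT₀).2 x h (mem_notInferred.mpr ⟨hh, hinf⟩)

theorem expectedNumQueries_samplingRound (hT : IsSortingTree (S : Set (Vec n)) T) (x : Vec n) :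
    expectedNumQueries (samplingRound T G S μ) x =
      T.numQueries x + expectedNumQueries (μ (notInferred G S x)) x := by
  rw [samplingRound, expectedNumQueries_randomBind, expectedNumQueries_map_map,
    notInferred_congr (hT.2 x)]

theorem InferenceDimensionLE.expectation_samples_le (hd : InferenceDimensionLE H d)
    (hG : (G : Set (Vec n)) ⊆ H) (hGn : G.Nonempty) {K : ℝ} (hK : 0 ≤ K) (x : Vec n) :
    expectation (PMF.uniformOfFinset (samples G (2 * d)) (samples_nonempty G (2 * d)))
      (fun S => ENNReal.ofReal (K + 4 * K * Real.log (1 + (notInferred G S x).card))) ≤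
        ENNReal.ofReal (4 * K * Real.log (1 + G.card)) := by
  have hlog (r : ℕ) : 0 ≤ Real.log (1 + r) := Real.log_nonneg (by simp)
  have hcard : ((samples G (2 * d)).card : ℝ) ≠ 0 :=
    Nat.cast_ne_zero.mpr (samples_nonempty G (2 * d)).card_pos.ne'
  have haverage := mul_le_mul_of_nonneg_left
    (inv_card_mul_sum_log_one_add_le (samples_nonempty G (2 * d)) hGn.card_pos
      (hd.two_mul_sum_card_notInferred_le hG x)) (by linarith : 0 ≤ 4 * K)
  rw [expectation_uniformOfFinset_ofReal _ _ fun S _ => by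
    have := hlog (notInferred G S x).card; positivity]
  refine ENNReal.ofReal_le_ofReal ?_
  rw [Finset.sum_add_distrib, Finset.sum_const, nsmul_eq_mul, ← Finset.mul_sum, mul_add,
    inv_mul_cancel_left₀ hcard, mul_left_comm]
  linarith

/-- The potential `4 * K * log (1 + G.card)` drops by `K` on average in a round. -/
theorem InferenceDimensionLE.exists_isRandomLabeling_of_ssubset (hd : InferenceDimensionLE H d)
    (hG : (G : Set (Vec n)) ⊆ H) (hGn : G.Nonempty) {K : ℝ} (hK : 0 ≤ K)
    {T : Finset (Vec n) → LinearDecisionTree n (Vec n)}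
    (hT : ∀ S : Finset (Vec n), S.card ≤ 2 * d → IsSortingTree (S : Set (Vec n)) (T S) ∧
      ∀ x, ((T S).numQueries x : ℝ) ≤ K)
    (hμ : ∀ R ⊂ G, IsRandomLabeling H R (μ R) ∧
      ∀ x, expectedNumQueries (μ R) x ≤ ENNReal.ofReal (4 * K * Real.log (1 + R.card))) :
    ∃ ν, IsRandomLabeling H G ν ∧
      ∀ x, expectedNumQueries ν x ≤ ENNReal.ofReal (4 * K * Real.log (1 + G.card)) := by
  have hsample (S : Finset (Vec n)) (hS : S ∈ samples G (2 * d)) :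
      S ⊆ G ∧ S.card ≤ 2 * d ∧ ∀ x, notInferred G S x ⊂ G := by
    obtain ⟨hSG, hcard⟩ := mem_samples.mp hS
    obtain ⟨h, hh⟩ : S.Nonempty := Finset.card_pos.mp <| by
      rw [hcard]
      exact lt_min (Nat.mul_pos two_pos hd.pos) hGn.card_pos
    exact ⟨hSG, hcard.trans_le (min_le_left _ _), fun _ =>
      notInferred_ssubset (hSG hh) (Finset.mem_coe.mpr hh)⟩
  refine ⟨(PMF.uniformOfFinset (samples G (2 * d)) (samples_nonempty G (2 * d))).bind
    fun S => samplingRound (T S) G S μ, .bind fun S hS => ?_, fun x => ?_⟩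
  · obtain ⟨hSG, hcard, hssub⟩ := hsample S ((PMF.mem_support_uniformOfFinset_iff _ _).mp hS)
    exact isRandomLabeling_samplingRound (hT S hcard).1
      ((Finset.coe_subset.mpr hSG).trans hG) fun y => (hμ _ (hssub y)).1
  · rw [expectedNumQueries, expectation_bind]
    refine (expectation_mono _ fun S hS => ?_).trans (hd.expectation_samples_le hG hGn hK x)
    obtain ⟨-, hcard, hssub⟩ := hsample S ((PMF.mem_support_uniformOfFinset_iff _ _).mp hS)
    have hlog : 0 ≤ Real.log (1 + (notInferred G S x).card) := Real.log_nonneg (by simp)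
    rw [← expectedNumQueries, expectedNumQueries_samplingRound (hT S hcard).1 x,
      ENNReal.ofReal_add hK (by positivity), ← ENNReal.ofReal_natCast]
    gcongr
    exacts [(hT S hcard).2 x, (hμ _ (hssub x)).2 x]

theorem InferenceDimensionLE.exists_isRandomLabeling (hd : InferenceDimensionLE H d) {K : ℝ}
    (hK : 0 ≤ K) (hsort : ∀ S : Finset (Vec n), S.card ≤ 2 * d → ∃ T,
      IsSortingTree (S : Set (Vec n)) T ∧ ∀ x, (T.numQueries x : ℝ) ≤ K)
    (hG : (G : Set (Vec n)) ⊆ H) :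
    ∃ ν, IsRandomLabeling H G ν ∧
      ∀ x, expectedNumQueries ν x ≤ ENNReal.ofReal (4 * K * Real.log (1 + G.card)) := by
  choose! T hT using hsort
  induction G using Finset.strongInduction with
  | H G ih =>
    obtain rfl | hGn := G.eq_empty_or_nonempty
    · refine ⟨PMF.pure (leaf 0), fun T hT => ?_, fun x => ?_⟩
      · rw [PMF.mem_support_pure_iff] at hT
        exact hT ▸ ⟨trivial, by simp⟩
      · simp [expectedNumQueries, expectation_pure, numQueries]
    · have : Nonempty (PMF (LinearDecisionTree n (Vec n → SignType))) := ⟨PMF.pure (leaf 0)⟩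
      choose! μ hμ using fun R (hR : R ⊂ G) => ih R hR ((Finset.coe_subset.mpr hR.1).trans hG)
      exact hd.exists_isRandomLabeling_of_ssubset hG hGn hK hT hμ

end Labeling

end PointLocation

open PointLocation LinearDecisionTree in
theorem mainTheorem4 :
    ∃ C : ℝ, 0 < C ∧
      ∀ (n : ℕ) (H : Finset (PointLocation.Vec n)) (d : ℕ),
        2 ≤ H.card →
        PointLocation.IsInferenceDimension (H : Set (PointLocation.Vec n)) d →
        ∃ R : PointLocation.ZeroErrorComparisonTree (H : Set (PointLocation.Vec n)),
          R.expectedQueryComplexity ≤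
            ENNReal.ofReal (C * (((d : ℝ) + (n : ℝ) * Real.log d) * Real.log H.card)) := by
  refine ⟨192, by norm_num, fun n H d hH hd => ?_⟩
  have hinf : InferenceDimensionLE (H : Set (Vec n)) d := hd.1.2
  have hd2 := hinf.two_le hH
  have hsort (S : Finset (Vec n)) (hS : S.card ≤ 2 * d) :
      ∃ T, IsSortingTree (S : Set (Vec n)) T ∧
        ∀ x, (T.numQueries x : ℝ) ≤ 24 * (d + n * Real.log d) := by
    obtain ⟨T, hT, hcost⟩ := exists_isSortingTree S
    exact ⟨T, hT, fun x => le_of_two_pow_le_sorting_bound hd2 hS (hcost x)⟩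
  obtain ⟨μ, hμ, hcost⟩ := hinf.exists_isRandomLabeling (by positivity) hsort subset_rfl
  obtain ⟨R, hR⟩ := hμ.exists_zeroErrorComparisonTree
  refine ⟨R, iSup_le fun x => (hR x).trans_le ((hcost x).trans (ENNReal.ofReal_le_ofReal ?_))⟩
  calc 4 * (24 * (d + n * Real.log d)) * Real.log (1 + H.card)
      ≤ 4 * (24 * (d + n * Real.log d)) * (2 * Real.log H.card) := by
        gcongr
        exact log_one_add_le_two_mul_log (by exact_mod_cast hH)
    _ = 192 * ((d + n * Real.log d) * Real.log H.card) := by ring
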